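/- Let $V$ be a finite set and let $Q(V)$ be the hypercube whose vertices are the subsets of $V$, two of them being adjacent if they differ in one element. A family $\mathcal A\subseteq 2^V$ is identified with the subgraph of $Q(V)$ that it induces. A set $X\subseteq V$ is shattered by $\mathcal A$ if $\{S\cap X: S\in\mathcal A\}=2^X$. The VC-dimension of $\mathcal A$ is the largest size of a shattered set. The family $\mathcal A$ is ample if $|\mathcal A|$ equals the number of sets that it shatters, and it is an ample partial cube if moreover its induced subgraph is isometric in $Q(V)$. A uniform oriented matroid (UOM) on a finite set $U$ with $|U|=m$ is a simple oriented matroid, given by its set of covectors in $\{-1,0,+1\}^U$, such that for some $r\le m$ its cocircuits (minimal nonzero covectors) are exactly two opposite signings of each subset of $U$ of size $m-r+1$. Its topes (maximal covectors) are $\pm1$-vectors and are viewed as subsets $\{e: T_e=+1\}$ of $U$. A family $\mathcal G\subseteq 2^V$ is called a UOM if there are disjoint $U,B\subseteq V$ and a UOM on $U$ such that $\mathcal G=\{B\cup T: T \text{ a tope}\}$. Let $\mathrm C(\mathcal G)=\{S:\bigcap\mathcal G\subseteq S\subseteq\bigcup\mathcal G\}$ be the smallest cube of $Q(V)$ containing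 $\mathcal G$. Call $\mathcal A$ an ample completion of $\mathcal G$ in $\mathrm C(\mathcal G)$ if $\mathcal A$ is an ample partial cube, $\mathcal G\subseteq\mathcal A\subseteq\mathrm C(\mathcal G)$, and $\mathcal A$ has the same VC-dimension as $\mathcal G$. Let $\mathcal G\subseteq 2^V$ be a UOM of VC-dimension $d$. Then $\mathcal G$ has an ample completion in $\mathrm C(\mathcal G)$, i.e. one of VC-dimension $d$. Moreover, such completions are obtained recursively as follows. Let $e\in\bigcup\mathcal G\setminus\bigcap\mathcal G$ (that is, $e$ defines a $\Theta$-class of $\mathcal G$), let $\pi_e(\mathcal F)=\{S\setminus\{e\}: S\in\mathcal F\}$ denote the contraction of $e$ in a family $\mathcal F\subseteq 2^V$, and let $\mathcal G_e^+=\{S\in\mathcal G: e\in S\}$. Then $\pi_e(\mathcal G)$ is a UOM, $\mathcal G_e^+$ and $\pi_e(\mathcal G_e^+)$ are ample partial cubes, and for every ample completion $\mathcal A'$ of $\pi_e(\mathcal G)$ in $\mathrm C(\pi_e(\mathcal G))$, the peripheral expansion $\mathcal A'\cup\{S\cup\{e\}: S\in\pi_e(\mathcal G_e^+)\}$ of $\mathcal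 A'$ along $\pi_e(\mathcal G_e^+)$ is an ample completion of $\mathcal G$ in $\mathrm C(\mathcal G)$. -/

import Mathlib

/-! ### Systems of sign vectors and oriented matroids -/

namespace SignSystem

variable {U : Type*}

/-- The product order on sign vectors for which `0 ≤ -1` and `0 ≤ +1`
(not the order `-1 < 0 < 1` of `SignType`). -/
def Conforms (X Y : U → SignType) : Prop :=
  ∀ e, X e = 0 ∨ X e = Y e

/-- The composition `X ∘ Y` of sign vectors. -/
def comp (X Y : U → SignType) : U → SignType :=
  fun e => if X e = 0 then Y e else X e

/-- The separator `S(X, Y)`. -/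
def separator (X Y : U → SignType) : Set U :=
  {e | X e * Y e = -1}

/-- The support of a sign vector. -/
def support [Fintype U] (X : U → SignType) : Finset U :=
  Finset.univ.filter fun e => X e ≠ 0

/-- The set of elements on which a sign vector is positive. -/
def positivePart [Fintype U] (X : U → SignType) : Finset U :=
  Finset.univ.filter fun e => X e = 1

/-- Oriented matroids, given by their covectors: composition, strong elimination, symmetry. -/
structure IsOrientedMatroid (L : Set (U → SignType)) : Prop where
  nonempty : L.Nonempty
  composition : ∀ X ∈ L, ∀ Y ∈ L, comp X Y ∈ L
  strongElimination : ∀ X ∈ L, ∀ Y ∈ L, ∀ e ∈ separator X Y,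
    ∃ Z ∈ L, Z e = 0 ∧ ∀ f, f ∉ separator X Y → Z f = comp X Y f
  symmetry : ∀ X ∈ L, -X ∈ L

/-- Simple systems of sign vectors: every element takes all three signs, and no two elements
are parallel or antiparallel. -/
structure IsSimple (L : Set (U → SignType)) : Prop where
  all_signs : ∀ (e : U) (s : SignType), ∃ X ∈ L, X e = s
  not_parallel : ∀ e f : U, e ≠ f →
    (∃ X ∈ L, X e * X f = 1) ∧ (∃ Y ∈ L, Y e * Y f = -1)

/-- Topes: the maximal covectors. -/
def IsTope (L : Set (U → SignType)) (T : U → SignType) : Prop :=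
  T ∈ L ∧ ∀ Y ∈ L, Conforms T Y → Y = T

/-- Cocircuits: the minimal nonzero covectors. -/
def IsCocircuit (L : Set (U → SignType)) (X : U → SignType) : Prop :=
  X ∈ L ∧ X ≠ 0 ∧ ∀ Y ∈ L, Y ≠ 0 → Conforms Y X → Y = X

/-- Uniformity: for some `r ≤ m = |U|`, the cocircuits are two opposite signings of each subset
of `U` of size `m - r + 1`. -/
def IsUniform [Fintype U] (L : Set (U → SignType)) : Prop :=
  ∃ r ≤ Fintype.card U,
    (∀ X, IsCocircuit L X → (support X).card + r = Fintype.card U + 1) ∧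
    ∀ A : Finset U, A.card + r = Fintype.card U + 1 →
      ∃ X, {Y | IsCocircuit L Y ∧ support Y = A} = {X, -X}

end SignSystem

/-! ### Set families as subgraphs of the hypercube -/

namespace SetFamily

variable {V : Type*} [DecidableEq V]

/-- The hypercube `Q(V)`: two sets are adjacent if they differ in exactly one element. -/
def hypercube (V : Type*) [DecidableEq V] : SimpleGraph (Finset V) where
  Adj S T := (symmDiff S T).card = 1
  symm := ⟨fun S T h => by rwa [symmDiff_comm]⟩
  loopless := ⟨fun S h => by simp at h⟩

/-- The 1-inclusion graph of a set family: the subgraph of the hypercube that it induces. -/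
def oneInclusionGraph (𝒜 : Finset (Finset V)) : SimpleGraph (𝒜 : Set (Finset V)) :=
  (hypercube V).induce (𝒜 : Set (Finset V))

/-- The 1-inclusion graph is an isometric subgraph of the hypercube (distances in `ℕ∞`, so this
includes connectedness). -/
def IsIsometric (𝒜 : Finset (Finset V)) : Prop :=
  ∀ S T : (𝒜 : Set (Finset V)),
    (oneInclusionGraph 𝒜).edist S T = (hypercube V).edist (S : Finset V) (T : Finset V)

/-- Ample families: the upper bound `|𝒜| ≤ |{X : 𝒜 shatters X}|` is attained. -/
def IsAmple (𝒜 : Finset (Finset V)) : Prop :=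
  𝒜.card = 𝒜.shatterer.card

/-- Ample partial cubes (isometrically embedded in the hypercube `Q(V)`). -/
def IsAmplePartialCube (𝒜 : Finset (Finset V)) : Prop :=
  IsAmple 𝒜 ∧ IsIsometric 𝒜

/-- The intersection of all members of a family. -/
def meet [Fintype V] (𝒢 : Finset (Finset V)) : Finset V := 𝒢.inf id

/-- The union of all members of a family. -/
def join (𝒢 : Finset (Finset V)) : Finset V := 𝒢.sup id

/-- The vertex set of the smallest cube `C(𝒢)` of `Q(V)` that contains `𝒢`. -/
def smallestCube [Fintype V] (𝒢 : Finset (Finset V)) : Finset (Finset V) :=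
  Finset.Icc (meet 𝒢) (join 𝒢)

/-- `𝒢` is the tope graph of a (simple) uniform oriented matroid on a subset `U` of the
coordinates, sitting in the `U`-cube of `Q(V)` whose least vertex is `B`. The case `U = V`, `B = ∅`
is that of the tope graph in its own hypercube. -/
def IsUOM (𝒢 : Finset (Finset V)) : Prop :=
  ∃ (U B : Finset V) (L : Set (U → SignType)),
    Disjoint U B ∧
    SignSystem.IsOrientedMatroid L ∧ SignSystem.IsSimple L ∧ SignSystem.IsUniform L ∧
    ∀ S : Finset V, S ∈ 𝒢 ↔ ∃ T, SignSystem.IsTope L T ∧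
      S = B ∪ (SignSystem.positivePart T).map (Function.Embedding.subtype _)

/-- `𝒜` is an ample completion of `𝒢` inside `C(𝒢)`: an ample partial cube of the same
VC-dimension with `𝒢 ⊆ 𝒜 ⊆ C(𝒢)`. -/
structure IsAmpleCompletion [Fintype V] (𝒢 𝒜 : Finset (Finset V)) : Prop where
  subset : 𝒢 ⊆ 𝒜
  subset_cube : 𝒜 ⊆ smallestCube 𝒢
  ample : IsAmplePartialCube 𝒜
  vcDim_eq : 𝒜.vcDim = 𝒢.vcDim

/-- The coordinates in which `𝒢` is not constant; for an isometric `𝒢` these are its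
`Θ`-classes. -/
def thetaClasses [Fintype V] (𝒢 : Finset (Finset V)) : Finset V := join 𝒢 \ meet 𝒢

/-- The contraction of the `Θ`-class `e`, in the facet of `Q(V)` formed by the sets without `e`. -/
def contraction (e : V) (𝒢 : Finset (Finset V)) : Finset (Finset V) :=
  𝒢.image fun S => S.erase e

/-- The halfspace of the members of `𝒢` that contain `e`. -/
def positiveHalfspace (e : V) (𝒢 : Finset (Finset V)) : Finset (Finset V) :=
  𝒢.filter fun S => e ∈ S

/-- The peripheral expansion of `𝒜` along its subgraph `ℋ` in the new direction `e`: each vertex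
of `ℋ` is doubled. -/
def peripheralExpansion (e : V) (𝒜 ℋ : Finset (Finset V)) : Finset (Finset V) :=
  𝒜 ∪ ℋ.image fun S => insert e S

end SetFamily

/-! ### Ample families -/

namespace SetFamily

open Finset

variable {V : Type*} [DecidableEq V]

/-! A family has at most as many members as shattered sets, and at least as many as strongly
shattered sets (direction sets of cubes it contains). So it is ample once every shattered set is
strongly shattered. Ampleness passes to intersections with cubes, and this forces isometry
(`IsAmple.isIsometric`).

Let `𝒢` be a UOM of rank `r` on `U`. Its shattered sets are the subsets of `U` of size at most `r`
(`IsTopeFamily.shatters_iff`). If the positive halfspace at `e` shatters `X`, then by antipodality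
so does the negative one; hence `𝒢` shatters `insert e X`, and `X` has at most `r - 1` elements.
Some cocircuit positive at `e` has a zero set of size `r - 1` containing `X`; composing it with
topes produces a cube in the halfspace with `X` among its directions. So the halfspace is ample
(`IsTopeFamily.isAmple_positiveHalfspace`).

Contracting `e` in the tope family is deleting `e` in the oriented matroid, which stays uniform
(`IsTopeFamily.contraction`). Expanding `𝒜` along `ℋ` adds `|ℋ|` members, and adds to the shattered
sets exactly the sets `insert e X` with `X` shattered by `ℋ` (`shatterer_peripheralExpansion`), so
ampleness survives. Those new sets are already shattered by `𝒢`, so the VC-dimension does not exceed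
that of `𝒢`. Induction on the set of Θ-classes starts from a single vertex. -/

lemma shatters_iff_forall_mem_iff {𝒜 : Finset (Finset V)} {X : Finset V} :
    𝒜.Shatters X ↔ ∀ Y ⊆ X, ∃ S ∈ 𝒜, ∀ x ∈ X, (x ∈ S ↔ x ∈ Y) := by
  refine forall_congr' fun Y => forall_congr' fun hY => exists_congr fun S =>
    and_congr_right fun _ => ?_
  rw [Finset.ext_iff]
  refine forall_congr' fun x => ?_
  have := @hY x
  rw [mem_inter]
  tauto

/-- A shattered set varies in each of its elements. -/
lemma Shatters.exists_mem_and_notMem {𝒜 : Finset (Finset V)} {X : Finset V} (h : 𝒜.Shatters X)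
    {x : V} (hx : x ∈ X) : (∃ S ∈ 𝒜, x ∈ S) ∧ ∃ S ∈ 𝒜, x ∉ S := by
  rw [shatters_iff_forall_mem_iff] at h
  obtain ⟨S, hS, h1⟩ := h X Subset.rfl
  obtain ⟨T, hT, h2⟩ := h ∅ (empty_subset _)
  exact ⟨⟨S, hS, (h1 x hx).2 hx⟩, T, hT, fun h => by simpa using (h2 x hx).1 h⟩

/-- If both halfspaces of `𝒜` at `e` shatter `X`, then `𝒜` shatters `insert e X`. -/
lemma shatters_insert_of_halfspaces {𝒜 : Finset (Finset V)} {X : Finset V} {e : V}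
    (h1 : (𝒜.filter fun S => e ∈ S).Shatters X) (h2 : (𝒜.filter fun S => e ∉ S).Shatters X) :
    𝒜.Shatters (insert e X) := by
  rw [shatters_iff_forall_mem_iff] at *
  intro Y hY
  by_cases he : e ∈ Y
  · obtain ⟨S, hS, h⟩ := h1 (Y ∩ X) inter_subset_right
    exact ⟨S, by grind, by grind⟩
  · obtain ⟨S, hS, h⟩ := h2 (Y ∩ X) inter_subset_right
    exact ⟨S, by grind, by grind⟩

lemma notMem_of_positiveHalfspace_shatters {𝒜 : Finset (Finset V)} {X : Finset V} {e : V}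
    (h : (positiveHalfspace e 𝒜).Shatters X) : e ∉ X := fun he => by
  obtain ⟨-, S, hS, h⟩ := Shatters.exists_mem_and_notMem h he
  exact h (mem_filter.1 hS).2

/-- A set `X` shattered by both halfspaces is counted twice on the left; the second count is charged
to `insert e X`, which neither halfspace shatters since each is constant at `e`. -/
lemma card_shatterer_halfspaces_add_le (e : V) (𝒜 : Finset (Finset V)) :
    (𝒜.filter fun S => e ∈ S).shatterer.card + (𝒜.filter fun S => e ∉ S).shatterer.card ≤
      𝒜.shatterer.card := by
  set P := (𝒜.filter fun S => e ∈ S).shatterer with hP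
  set N := (𝒜.filter fun S => e ∉ S).shatterer with hN
  have hPe : ∀ X ∈ P, e ∉ X := fun X hX he => by
    obtain ⟨-, S, hS, h⟩ := Shatters.exists_mem_and_notMem (mem_shatterer.1 hX) he
    exact h (mem_filter.1 hS).2
  have hNe : ∀ X ∈ N, e ∉ X := fun X hX he => by
    obtain ⟨⟨S, hS, h⟩, -⟩ := Shatters.exists_mem_and_notMem (mem_shatterer.1 hX) he
    exact (mem_filter.1 hS).2 h
  have hinj : ((P ∩ N).image (insert e)).card = (P ∩ N).card := by
    refine card_image_of_injOn fun X hX Y hY h => ?_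
    have h1 := hPe X (mem_inter.1 hX).1
    have h2 := hPe Y (mem_inter.1 hY).1
    rw [← erase_insert h1, h, erase_insert h2]
  rw [← card_union_add_card_inter, ← hinj, ← card_union_of_disjoint]
  · refine card_le_card (union_subset (union_subset ?_ ?_) ?_)
    · exact shatterer_mono (filter_subset _ _)
    · exact shatterer_mono (filter_subset _ _)
    · intro Y hY
      obtain ⟨X, hX, rfl⟩ := mem_image.1 hY
      rw [mem_inter, hP, hN, mem_shatterer, mem_shatterer] at hX
      exact mem_shatterer.2 (shatters_insert_of_halfspaces hX.1 hX.2)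
  · rw [disjoint_right]
    intro Y hY h
    obtain ⟨X, -, rfl⟩ := mem_image.1 hY
    rcases mem_union.1 h with h | h
    · exact hPe _ h (mem_insert_self _ _)
    · exact hNe _ h (mem_insert_self _ _)

/-- The two inequalities `|ℬ| ≤ |ℬ.shatterer|` for the halfspaces add up to an equality, so neither
can be strict. -/
lemma IsAmple.halfspaces {𝒜 : Finset (Finset V)} (h : IsAmple 𝒜) (e : V) :
    IsAmple (𝒜.filter fun S => e ∈ S) ∧ IsAmple (𝒜.filter fun S => e ∉ S) := by
  unfold IsAmple at *
  have h1 := card_shatterer_halfspaces_add_le e 𝒜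
  have h2 := card_le_card_shatterer (𝒜.filter fun S => e ∈ S)
  have h3 := card_le_card_shatterer (𝒜.filter fun S => e ∉ S)
  have h4 := card_filter_add_card_filter_not (s := 𝒜) (fun S => e ∈ S)
  omega

/-- The members of an ample family that lie in a given cube form an ample family. -/
lemma IsAmple.filter_agree {𝒜 : Finset (Finset V)} (h : IsAmple 𝒜) (D S : Finset V) :
    IsAmple (𝒜.filter fun R => ∀ x ∈ D, (x ∈ R ↔ x ∈ S)) := by
  induction D using Finset.induction_on with
  | empty => simpa using h
  | insert e D _ ih =>
    by_cases he : e ∈ S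
    · convert (ih.halfspaces e).1 using 1
      ext R; simp [he]; tauto
    · convert (ih.halfspaces e).2 using 1
      ext R; simp [he]; tauto

/-! ### Isometry of ample families -/

lemma card_symmDiff_le_length {S T : Finset V} (w : (hypercube V).Walk S T) :
    (symmDiff S T).card ≤ w.length := by
  induction w with
  | nil => simp
  | @cons S R T hadj p ih =>
    have h1 : (symmDiff S R).card = 1 := hadj
    have h2 := card_le_card (symmDiff_triangle S R T)
    have h3 := card_union_le (symmDiff S R) (symmDiff R T)
    simp only [SimpleGraph.Walk.length_cons]
    simp only [sup_eq_union] at h2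
    omega

/-- The members in the cube spanned by `S` and `T` form an ample family that shatters `∅` and every
singleton of `symmDiff S T`. That is at least three sets, so there is a third member. -/
lemma IsAmple.exists_between [Fintype V] {𝒜 : Finset (Finset V)} (h : IsAmple 𝒜)
    {S T : Finset V} (hS : S ∈ 𝒜) (hT : T ∈ 𝒜) (hc : 2 ≤ (symmDiff S T).card) :
    ∃ R ∈ 𝒜, R ≠ S ∧ R ≠ T ∧ (symmDiff S R).card + (symmDiff R T).card = (symmDiff S T).card := by
  set ℬ := 𝒜.filter fun R => ∀ x ∈ univ \ symmDiff S T, (x ∈ R ↔ x ∈ S) with hℬ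
  have hamp : IsAmple ℬ := by convert h.filter_agree (univ \ symmDiff S T) S
  have hSB : S ∈ ℬ := by simp [hℬ, hS]
  have hTB : T ∈ ℬ := by
    simp only [hℬ, mem_filter, hT, true_and]
    intro x hx
    simp [mem_symmDiff] at hx
    tauto
  have hex : ∃ R ∈ ℬ, R ≠ S ∧ R ≠ T := by
    by_contra! hcon
    have hle : ℬ.card ≤ 2 := by
      refine (card_le_card (t := {S, T}) fun R hR => ?_).trans card_le_two
      by_cases hRS : R = S
      · simp [hRS]
      · simp [hcon R hR hRS]
    have hge : ((insert ∅ ((symmDiff S T).image fun x => ({x} : Finset V)))).card ≤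
        ℬ.shatterer.card := by
      refine card_le_card fun X hX => ?_
      rw [mem_shatterer, shatters_iff_forall_mem_iff]
      rcases mem_insert.1 hX with rfl | hX
      · exact fun Y _ => ⟨S, hSB, by simp⟩
      · obtain ⟨x, hx, rfl⟩ := mem_image.1 hX
        intro Y _
        simp only [mem_singleton, forall_eq]
        rw [mem_symmDiff] at hx
        by_cases hxY : x ∈ Y
        · rcases hx with hx | hx
          · exact ⟨S, hSB, by tauto⟩
          · exact ⟨T, hTB, by tauto⟩
        · rcases hx with hx | hx
          · exact ⟨T, hTB, by tauto⟩
          · exact ⟨S, hSB, by tauto⟩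
    rw [card_insert_of_notMem (by simp), card_image_of_injective _ singleton_injective] at hge
    have : ℬ.card = ℬ.shatterer.card := hamp
    omega
  obtain ⟨R, hR, h1, h2⟩ := hex
  refine ⟨R, (mem_filter.1 hR).1, h1, h2, ?_⟩
  have hag : ∀ x, x ∉ symmDiff S T → (x ∈ R ↔ x ∈ S) := fun x hx =>
    (mem_filter.1 hR).2 x (by simpa using hx)
  rw [← card_union_of_disjoint]
  · congr 1
    ext x
    have := hag x
    simp only [mem_union, mem_symmDiff] at *
    tauto
  · rw [disjoint_left]
    intro x
    have := hag x
    simp only [mem_symmDiff] at *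
    tauto

lemma IsAmple.edist_le_card_symmDiff [Fintype V] {𝒜 : Finset (Finset V)} (h : IsAmple 𝒜) (n : ℕ) :
    ∀ S T : (𝒜 : Set (Finset V)), (symmDiff (S : Finset V) T).card = n →
      (oneInclusionGraph 𝒜).edist S T ≤ n := by
  induction n using Nat.strong_induction_on with
  | _ n ih =>
    rintro ⟨S, hS⟩ ⟨T, hT⟩ hn
    simp only at hn
    by_cases h2 : 2 ≤ n
    · obtain ⟨R, hR, hRS, hRT, hsum⟩ := h.exists_between hS hT (by omega)
      have p1 : 0 < (symmDiff S R).card := by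
        rw [card_pos, nonempty_iff_ne_empty, ← bot_eq_empty, Ne, symmDiff_eq_bot]
        exact fun h => hRS h.symm
      have p2 : 0 < (symmDiff R T).card := by
        rw [card_pos, nonempty_iff_ne_empty, ← bot_eq_empty, Ne, symmDiff_eq_bot]
        exact hRT
      refine (SimpleGraph.edist_triangle (v := (⟨R, hR⟩ : (𝒜 : Set (Finset V))))).trans ?_
      rw [← hn, ← hsum, Nat.cast_add]
      exact add_le_add (ih _ (by omega) ⟨S, hS⟩ ⟨R, hR⟩ rfl) (ih _ (by omega) ⟨R, hR⟩ ⟨T, hT⟩ rfl)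
    · interval_cases n
      · rw [card_eq_zero, ← bot_eq_empty, symmDiff_eq_bot] at hn
        subst hn
        simp
      · have hadj : (oneInclusionGraph 𝒜).Adj ⟨S, hS⟩ ⟨T, hT⟩ := hn
        rw [SimpleGraph.edist_eq_one_iff_adj.2 hadj]
        rfl

/-- Ample families are isometric. -/
lemma IsAmple.isIsometric [Fintype V] {𝒜 : Finset (Finset V)} (h : IsAmple 𝒜) :
    IsIsometric 𝒜 := by
  intro S T
  apply le_antisymm
  · refine (h.edist_le_card_symmDiff _ S T rfl).trans ?_
    rw [SimpleGraph.edist_eq_sInf]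
    refine le_sInf ?_
    rintro _ ⟨w, rfl⟩
    exact Nat.cast_le.2 (card_symmDiff_le_length w)
  · rw [SimpleGraph.edist_eq_sInf (G := oneInclusionGraph 𝒜)]
    refine le_sInf ?_
    rintro _ ⟨w, rfl⟩
    have := SimpleGraph.edist_le
      (w.map (SimpleGraph.Embedding.induce (G := hypercube V) (𝒜 : Set (Finset V))).toHom)
    exact this.trans (Nat.cast_le.2 (SimpleGraph.Walk.length_map _ w).le)

lemma IsAmple.isAmplePartialCube [Fintype V] {𝒜 : Finset (Finset V)} (h : IsAmple 𝒜) :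
    IsAmplePartialCube 𝒜 :=
  ⟨h, h.isIsometric⟩

/-- `𝒜` contains a cube with direction set `X`. -/
def StronglyShatters (𝒜 : Finset (Finset V)) (X : Finset V) : Prop :=
  ∃ R : Finset V, ∀ S : Finset V, (∀ x ∉ X, (x ∈ S ↔ x ∈ R)) → S ∈ 𝒜

/-- All sets with the same trace on `Xᶜ` as `R` lie in the cube, hence in `𝒜`, so `𝒜ᶜ` misses that
trace. -/
lemma StronglyShatters.not_shatters_compl [Fintype V] {𝒜 : Finset (Finset V)} {X : Finset V}
    (h : StronglyShatters 𝒜 X) : ¬ (𝒜ᶜ).Shatters Xᶜ := by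
  rw [shatters_iff_forall_mem_iff]
  intro hs
  obtain ⟨R, hR⟩ := h
  obtain ⟨S, hS, h⟩ := hs (R ∩ Xᶜ) inter_subset_right
  exact mem_compl.1 hS (hR S fun x hx => by simpa [hx] using h x (mem_compl.2 hx))

/-- A family has at least as many members as there are sets that it strongly shatters. -/
lemma card_le_of_forall_stronglyShatters [Fintype V] {𝒜 𝒮 : Finset (Finset V)}
    (h : ∀ X ∈ 𝒮, StronglyShatters 𝒜 X) : 𝒮.card ≤ 𝒜.card := by
  -- The Pajor bound for `𝒜ᶜ`: complements of strongly shattered sets avoid its shatterer, so `𝒮`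
  -- has at most `2 ^ |V| - |𝒜ᶜ|` sets.
  have h1 := card_le_card_shatterer 𝒜ᶜ
  have h2 : Disjoint (𝒮.image compl) (𝒜ᶜ).shatterer := by
    rw [disjoint_left]
    intro Y hY hs
    obtain ⟨X, hX, rfl⟩ := mem_image.1 hY
    exact (h X hX).not_shatters_compl (mem_shatterer.1 hs)
  have h3 := card_le_univ (𝒮.image compl ∪ (𝒜ᶜ).shatterer)
  rw [card_union_of_disjoint h2, card_image_of_injective _ compl_injective] at h3
  have h4 := card_compl_add_card 𝒜
  omega

lemma isAmple_of_forall_stronglyShatters [Fintype V] {𝒜 : Finset (Finset V)}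
    (h : ∀ X, 𝒜.Shatters X → StronglyShatters 𝒜 X) : IsAmple 𝒜 :=
  (card_le_card_shatterer 𝒜).antisymm
    (card_le_of_forall_stronglyShatters fun X hX => h X (mem_shatterer.1 hX))

/-! ### Contractions and expansions -/

lemma shatters_contraction_iff {𝒜 : Finset (Finset V)} {e : V} {X : Finset V} (he : e ∉ X) :
    (contraction e 𝒜).Shatters X ↔ 𝒜.Shatters X := by
  simp only [shatters_iff_forall_mem_iff, contraction, mem_image, exists_exists_and_eq_and]
  refine forall_congr' fun Y => forall_congr' fun hY => exists_congr fun S =>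
    and_congr_right fun _ => forall_congr' fun x => forall_congr' fun hx => ?_
  have : x ≠ e := by rintro rfl; exact he hx
  simp [this]

lemma notMem_of_contraction_shatters {𝒜 : Finset (Finset V)} {e : V} {X : Finset V}
    (h : (contraction e 𝒜).Shatters X) : e ∉ X := fun he => by
  obtain ⟨⟨S, hS, h⟩, -⟩ := Shatters.exists_mem_and_notMem h he
  obtain ⟨T, -, rfl⟩ := mem_image.1 hS
  simp at h

lemma vcDim_contraction_le (e : V) (𝒜 : Finset (Finset V)) :
    (contraction e 𝒜).vcDim ≤ 𝒜.vcDim :=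
  Finset.sup_mono fun X hX => by
    rw [mem_shatterer] at *
    exact (shatters_contraction_iff (notMem_of_contraction_shatters hX)).1 hX

lemma card_contraction_positiveHalfspace (e : V) (𝒜 : Finset (Finset V)) :
    (contraction e (positiveHalfspace e 𝒜)).card = (positiveHalfspace e 𝒜).card := by
  refine card_image_of_injOn fun S hS T hT h => ?_
  have h1 : e ∈ S := (mem_filter.1 hS).2
  have h2 : e ∈ T := (mem_filter.1 hT).2
  rw [← insert_erase h1, ← insert_erase h2]
  exact congrArg (insert e) h

lemma shatterer_contraction_positiveHalfspace (e : V) (𝒜 : Finset (Finset V)) :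
    (contraction e (positiveHalfspace e 𝒜)).shatterer = (positiveHalfspace e 𝒜).shatterer := by
  ext X
  rw [mem_shatterer, mem_shatterer]
  constructor
  · exact fun h => (shatters_contraction_iff (notMem_of_contraction_shatters h)).1 h
  · exact fun h => (shatters_contraction_iff (notMem_of_positiveHalfspace_shatters h)).2 h

lemma IsAmple.contraction_positiveHalfspace {e : V} {𝒜 : Finset (Finset V)}
    (h : IsAmple (positiveHalfspace e 𝒜)) :
    IsAmple (contraction e (positiveHalfspace e 𝒜)) := by
  rw [IsAmple, card_contraction_positiveHalfspace, shatterer_contraction_positiveHalfspace]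
  exact h

/-! ### Shattering in peripheral expansions -/

section Expansion

variable {e : V} {𝒜 ℋ : Finset (Finset V)}

lemma card_peripheralExpansion (h𝒜 : ∀ S ∈ 𝒜, e ∉ S) (hℋ : ∀ S ∈ ℋ, e ∉ S) :
    (peripheralExpansion e 𝒜 ℋ).card = 𝒜.card + ℋ.card := by
  rw [peripheralExpansion, card_union_of_disjoint, card_image_of_injOn]
  · intro S hS T hT h
    rw [← erase_insert (hℋ S hS), ← erase_insert (hℋ T hT)]
    exact congrArg (fun R => R.erase e) h
  · rw [disjoint_left]
    intro S hS h
    obtain ⟨T, -, rfl⟩ := mem_image.1 h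
    exact h𝒜 _ hS (mem_insert_self _ _)

/-- A set avoiding `e` cannot distinguish `T` from `insert e T`, so the doubled vertices contribute
nothing new to it. For a set containing `e`, the patterns with `e` must come from `ℋ`, and since `ℋ
⊆ 𝒜` those without `e` then come for free. -/
lemma shatterer_peripheralExpansion (h𝒜 : ∀ S ∈ 𝒜, e ∉ S) (hsub : ℋ ⊆ 𝒜) :
    (peripheralExpansion e 𝒜 ℋ).shatterer = peripheralExpansion e 𝒜.shatterer ℋ.shatterer := by
  have hmem : ∀ S, S ∈ peripheralExpansion e 𝒜 ℋ ↔ S ∈ 𝒜 ∨ ∃ T ∈ ℋ, insert e T = S := by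
    simp [peripheralExpansion]
  ext X
  simp only [peripheralExpansion, mem_union, mem_image, mem_shatterer]
  simp only [shatters_iff_forall_mem_iff]
  constructor
  · intro h
    by_cases he : e ∈ X
    · right
      refine ⟨X.erase e, fun Y hY => ?_, insert_erase he⟩
      obtain ⟨S, hS, h⟩ := h (insert e Y) (by grind)
      rcases mem_union.1 hS with hS | hS
      · exact absurd ((h e he).2 (mem_insert_self _ _)) (h𝒜 S hS)
      · obtain ⟨T, hT, rfl⟩ := mem_image.1 hS
        exact ⟨T, hT, by grind⟩
    · left
      intro Y hY
      obtain ⟨S, hS, h⟩ := h Y hY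
      rcases mem_union.1 hS with hS | hS
      · exact ⟨S, hS, h⟩
      · obtain ⟨T, hT, rfl⟩ := mem_image.1 hS
        exact ⟨T, hsub hT, by grind⟩
  · rintro (h | ⟨X, h, rfl⟩) Y hY
    · obtain ⟨S, hS, h⟩ := h Y hY
      exact ⟨S, mem_union_left _ hS, h⟩
    · obtain ⟨S, hS, h⟩ := h (Y ∩ X) inter_subset_right
      by_cases he : e ∈ Y
      · exact ⟨insert e S, mem_union_right _ (mem_image_of_mem _ hS), by grind⟩
      · exact ⟨S, mem_union_left _ (hsub hS), by grind⟩

lemma IsAmple.peripheralExpansion (h1 : IsAmple 𝒜) (h2 : IsAmple ℋ) (h𝒜 : ∀ S ∈ 𝒜, e ∉ S)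
    (hsub : ℋ ⊆ 𝒜) : IsAmple (peripheralExpansion e 𝒜 ℋ) := by
  have hs : ∀ ℬ : Finset (Finset V), (∀ S ∈ ℬ, e ∉ S) → ∀ X ∈ ℬ.shatterer, e ∉ X :=
    fun ℬ hB X hX he => by
      obtain ⟨⟨S, hS, h⟩, -⟩ := Shatters.exists_mem_and_notMem (mem_shatterer.1 hX) he
      exact hB S hS h
  have hℋ : ∀ S ∈ ℋ, e ∉ S := fun S hS => h𝒜 S (hsub hS)
  rw [IsAmple, shatterer_peripheralExpansion h𝒜 hsub, card_peripheralExpansion h𝒜 hℋ,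
    card_peripheralExpansion (hs _ h𝒜) (hs _ hℋ), ← h1, ← h2]

end Expansion

/-! ### Smallest cubes, Θ-classes and the expansion of completions -/

section Cube

variable {𝒢 : Finset (Finset V)}

lemma subset_join {S : Finset V} (hS : S ∈ 𝒢) : S ⊆ join 𝒢 := Finset.le_sup (f := id) hS

lemma mem_join {v : V} : v ∈ join 𝒢 ↔ ∃ S ∈ 𝒢, v ∈ S := by
  simp [join, Finset.mem_sup]

variable [Fintype V]

lemma meet_subset {S : Finset V} (hS : S ∈ 𝒢) : meet 𝒢 ⊆ S := Finset.inf_le (f := id) hS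

lemma mem_smallestCube {S : Finset V} (hS : S ∈ 𝒢) : S ∈ smallestCube 𝒢 :=
  Finset.mem_Icc.2 ⟨meet_subset hS, subset_join hS⟩

lemma mem_meet {v : V} : v ∈ meet 𝒢 ↔ ∀ S ∈ 𝒢, v ∈ S := by
  rw [← singleton_subset_iff, meet, Finset.le_inf_iff]
  simp

lemma mem_thetaClasses {v : V} :
    v ∈ thetaClasses 𝒢 ↔ (∃ S ∈ 𝒢, v ∈ S) ∧ ∃ S ∈ 𝒢, v ∉ S := by
  simp [thetaClasses, mem_meet, mem_join]

lemma thetaClasses_contraction_ssubset {e : V} (he : e ∈ thetaClasses 𝒢) :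
    thetaClasses (contraction e 𝒢) ⊂ thetaClasses 𝒢 := by
  refine Finset.ssubset_iff_subset_ne.2 ⟨fun v hv => ?_, fun h => ?_⟩
  · by_cases hve : v = e
    · rwa [hve]
    · simpa [mem_thetaClasses, contraction, hve] using hv
  · rw [← h, mem_thetaClasses] at he
    simp [contraction] at he

lemma smallestCube_contraction_subset {e : V} (he : e ∈ thetaClasses 𝒢) :
    smallestCube (contraction e 𝒢) ⊆ smallestCube 𝒢 := by
  refine Finset.Icc_subset_Icc (fun v hv => ?_) (fun v hv => ?_)
  -- An `e` common to all members would be erased from the meet, and the contraction would leave the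
  -- cube.
  · have hve : v ≠ e := by
      rintro rfl
      obtain ⟨S, hS, h⟩ := (mem_thetaClasses.1 he).2
      exact h (mem_meet.1 hv S hS)
    simpa [mem_meet, contraction, hve] using hv
  · simp only [mem_join, contraction, mem_image, exists_exists_and_eq_and, mem_erase] at *
    obtain ⟨S, hS, -, h⟩ := hv
    exact ⟨S, hS, h⟩

/-- Expanding an ample completion of the contraction of `e` along the positive halfspace of `e`. -/
lemma IsAmpleCompletion.peripheralExpansion {e : V} (he : e ∈ thetaClasses 𝒢)
    (hamp : IsAmple (positiveHalfspace e 𝒢))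
    (hins : ∀ X, (positiveHalfspace e 𝒢).Shatters X → 𝒢.Shatters (insert e X))
    {𝒜 : Finset (Finset V)} (h : IsAmpleCompletion (contraction e 𝒢) 𝒜) :
    IsAmpleCompletion 𝒢
      (peripheralExpansion e 𝒜 (contraction e (positiveHalfspace e 𝒢))) := by
  set ℋ := contraction e (positiveHalfspace e 𝒢) with hℋ
  have hsub : ℋ ⊆ 𝒜 := (image_subset_image (filter_subset _ _)).trans h.subset
  have h𝒜 : ∀ S ∈ 𝒜, e ∉ S := fun S hS heS => by
    have := (Finset.mem_Icc.1 (h.subset_cube hS)).2 heS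
    simp [mem_join, contraction] at this
  have hG : 𝒢 ⊆ SetFamily.peripheralExpansion e 𝒜 ℋ := fun S hS => by
    by_cases heS : e ∈ S
    · refine mem_union_right _ (mem_image.2 ⟨S.erase e, ?_, insert_erase heS⟩)
      exact mem_image_of_mem _ (mem_filter.2 ⟨hS, heS⟩)
    · refine mem_union_left _ (h.subset ?_)
      exact mem_image.2 ⟨S, hS, erase_eq_of_notMem heS⟩
  refine ⟨hG, ?_, ?_, le_antisymm ?_ (vcDim_mono hG)⟩
  · refine union_subset (h.subset_cube.trans (smallestCube_contraction_subset he)) fun S hS => ?_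
    obtain ⟨T, hT, rfl⟩ := mem_image.1 hS
    obtain ⟨R, hR, rfl⟩ := mem_image.1 hT
    have := mem_filter.1 hR
    rw [insert_erase this.2]
    exact mem_smallestCube this.1
  · exact (h.ample.1.peripheralExpansion hamp.contraction_positiveHalfspace h𝒜
      hsub).isAmplePartialCube
  · unfold vcDim
    rw [shatterer_peripheralExpansion h𝒜 hsub]
    refine Finset.sup_le fun X hX => ?_
    rcases mem_union.1 hX with hX | hX
    · exact (mem_shatterer.1 hX).card_le_vcDim.trans
        (h.vcDim_eq.le.trans (vcDim_contraction_le e 𝒢))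
    -- The sets containing `e` are the only ones that could raise the VC-dimension, and `hins` says
    -- that `𝒢` already shatters them.
    · obtain ⟨Y, hY, rfl⟩ := mem_image.1 hX
      rw [hℋ, shatterer_contraction_positiveHalfspace, mem_shatterer] at hY
      exact (hins Y hY).card_le_vcDim

end Cube

end SetFamily

/-! ### Uniform oriented matroids -/

namespace SignSystem

open Finset

variable {U : Type*} {L : Set (U → SignType)}

lemma Conforms.trans {X Y Z : U → SignType} (h1 : Conforms X Y) (h2 : Conforms Y Z) :
    Conforms X Z := fun e => by
  rcases h1 e with h | h
  · exact Or.inl h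
  · rw [h]; exact h2 e

lemma comp_of_ne_zero {X Y : U → SignType} {e : U} (h : X e ≠ 0) : comp X Y e = X e := if_neg h

lemma comp_of_eq_zero {X Y : U → SignType} {e : U} (h : X e = 0) : comp X Y e = Y e := if_pos h

lemma comp_ne_zero {X Y : U → SignType} {e : U} (h : X e ≠ 0 ∨ Y e ≠ 0) : comp X Y e ≠ 0 := by
  unfold comp
  split_ifs with h'
  · exact h.resolve_left (not_not.2 h')
  · exact h'

lemma conforms_comp (X Y : U → SignType) : Conforms X (comp X Y) := fun e => by
  by_cases h : X e = 0
  · exact Or.inl h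
  · exact Or.inr (comp_of_ne_zero h).symm

lemma eq_of_mul_ne_neg_one {a b : SignType} (ha : a ≠ 0) (hb : b ≠ 0) (h : a * b ≠ -1) :
    a = b := by
  revert a b; decide

lemma eq_neg_one_of_ne {a : SignType} (h0 : a ≠ 0) (h1 : a ≠ 1) : a = -1 := by
  revert a; decide

lemma eq_neg_of_mul_eq_neg_one {a b : SignType} (h : a * b = -1) : b = -a := by
  revert a b; decide

section Fintype

variable [Fintype U]

lemma mem_support {X : U → SignType} {e : U} : e ∈ support X ↔ X e ≠ 0 := by
  simp [support]

lemma support_nonempty {X : U → SignType} (h : X ≠ 0) : (support X).Nonempty := by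
  obtain ⟨e, he⟩ := Function.ne_iff.1 h
  exact ⟨e, mem_support.2 he⟩

lemma support_neg (X : U → SignType) : support (-X) = support X := by
  ext e
  simp [mem_support]

lemma Conforms.support_subset {X Y : U → SignType} (h : Conforms X Y) :
    support X ⊆ support Y := fun e he => by
  rw [mem_support] at *
  rwa [← (h e).resolve_left he]

lemma Conforms.eq_of_support_subset {X Y : U → SignType} (h : Conforms X Y)
    (hs : support Y ⊆ support X) : X = Y := by
  funext e
  rcases h e with h0 | h0
  · have : e ∉ support Y := fun he => (mem_support.1 (hs he)) h0
    rw [mem_support, not_not] at this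
    rw [h0, this]
  · exact h0

lemma exists_isCocircuit_conforms {X : U → SignType} (hX : X ∈ L) (h0 : X ≠ 0) :
    ∃ Y, IsCocircuit L Y ∧ Conforms Y X := by
  induction h : (support X).card using Nat.strong_induction_on generalizing X with
  | _ n ih =>
    by_cases hc : IsCocircuit L X
    · exact ⟨X, hc, fun _ => Or.inr rfl⟩
    · unfold IsCocircuit at hc
      push Not at hc
      obtain ⟨Y, hY, hY0, hYX, hne⟩ := hc hX h0
      have hlt : (support Y).card < n := by
        rw [← h]
        refine card_lt_card (Finset.ssubset_iff_subset_ne.2 ⟨hYX.support_subset, fun heq => ?_⟩)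
        exact hne (hYX.eq_of_support_subset heq.ge)
      obtain ⟨Z, hZ, hZY⟩ := ih _ hlt hY hY0 rfl
      exact ⟨Z, hZ, hZY.trans hYX⟩

/-- If the support of a nonzero covector `X` is strictly contained in that of `W`, then there is
such an `X` that conforms to `W`. -/
lemma IsOrientedMatroid.exists_conforms_of_support_ssubset (hL : IsOrientedMatroid L)
    {W X : U → SignType} (hW : W ∈ L) (hX : X ∈ L) (hX0 : X ≠ 0)
    (hs : support X ⊂ support W) : ∃ Y ∈ L, Y ≠ 0 ∧ Conforms Y W ∧ Y ≠ W := by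
  classical
  -- Each elimination between `W` and `X` removes a sign conflict with `W` and creates none.
  induction h : (univ.filter fun e => W e * X e = -1).card using Nat.strong_induction_on
    generalizing X with
  | _ n ih =>
    by_cases hsep : (univ.filter fun e => W e * X e = -1).Nonempty
    · obtain ⟨e, he⟩ := hsep
      have he' : W e * X e = -1 := (mem_filter.1 he).2
      obtain ⟨Z, hZ, hZe, hZf⟩ := hL.strongElimination W hW X hX e he'
      have hZf' : ∀ f, W f * X f ≠ -1 → Z f = comp W X f := hZf
      have hsub : ∀ f, W f = 0 → Z f = 0 := fun f hf => by
        have hXf : X f = 0 := by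
          by_contra hne
          exact mem_support.1 (hs.1 (mem_support.2 hne)) hf
        rw [hZf' f (by rw [hf, zero_mul]; decide), comp_of_eq_zero hf, hXf]
      -- Outside the support of `X`, elimination keeps the sign of `W`; this makes `Z` nonzero.
      obtain ⟨f, hfW, hfX⟩ := exists_of_ssubset hs
      rw [mem_support] at hfW
      rw [mem_support, not_not] at hfX
      have hZf0 : Z f = W f := by
        rw [hZf' f (by rw [hfX, mul_zero]; decide), comp_of_ne_zero hfW]
      have hZ0 : Z ≠ 0 := fun h => hfW (by rw [← hZf0, h]; rfl)
      refine ih _ ?_ hZ hZ0 ⟨fun g hg => ?_, fun hle => ?_⟩ rfl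
      · rw [← h]
        refine card_lt_card ⟨fun g hg => ?_, fun hle => ?_⟩
        · rw [mem_filter] at *
          refine ⟨mem_univ _, ?_⟩
          by_contra hne
          have hW0 : W g ≠ 0 := fun h0 => by
            have := hg.2
            rw [h0, zero_mul] at this
            exact absurd this (by decide)
          have := hg.2
          rw [hZf' g hne, comp_of_ne_zero hW0] at this
          generalize W g = a at this
          revert a; decide
        · have := (mem_filter.1 (hle he)).2
          rw [hZe, mul_zero] at this
          exact absurd this (by decide)
      · rw [mem_support] at *
        exact fun h0 => hg (hsub g h0)
      · refine mem_support.1 (hle (x := e) (mem_support.2 fun h0 => ?_)) hZe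
        rw [h0, zero_mul] at he'
        exact absurd he' (by decide)
    · refine ⟨X, hX, hX0, fun e => ?_, fun heq => hs.2 (heq ▸ Subset.rfl)⟩
      by_cases hXe : X e = 0
      · exact Or.inl hXe
      · refine Or.inr (eq_of_mul_ne_neg_one (mem_support.1 (hs.1 (mem_support.2 hXe))) hXe ?_).symm
        intro he
        exact hsep ⟨e, mem_filter.2 ⟨mem_univ _, he⟩⟩

/-- Nonzero covectors have support of size at least `|U| - r + 1`, and all sets of this size are
supports of covectors. -/
structure HasUniformRank (L : Set (U → SignType)) (r : ℕ) : Prop where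
  le_card : r ≤ Fintype.card U
  le_card_support : ∀ X ∈ L, X ≠ 0 → Fintype.card U + 1 ≤ (support X).card + r
  exists_support_eq : ∀ A : Finset U, A.card + r = Fintype.card U + 1 → ∃ X ∈ L, support X = A

lemma IsUniform.exists_hasUniformRank (h : IsUniform L) : ∃ r, HasUniformRank L r := by
  obtain ⟨r, hr, h1, h2⟩ := h
  refine ⟨r, hr, fun X hX h0 => ?_, fun A hA => ?_⟩
  · obtain ⟨Y, hY, hYX⟩ := exists_isCocircuit_conforms hX h0
    have := card_le_card hYX.support_subset
    have := h1 Y hY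
    omega
  · obtain ⟨X, hX⟩ := h2 A hA
    have : X ∈ {Y | IsCocircuit L Y ∧ support Y = A} := by rw [hX]; simp
    exact ⟨X, this.1.1, this.2⟩

/-- This allows uniformity of a deletion to be checked on supports alone, without determining its
cocircuits. -/
lemma HasUniformRank.isUniform (hL : IsOrientedMatroid L) {r : ℕ} (h : HasUniformRank L r) :
    IsUniform L := by
  classical
  have hmin : ∀ X ∈ L, (support X).card + r = Fintype.card U + 1 → IsCocircuit L X := by
    refine fun X hX hc => ⟨hX, ?_, fun Y hY hY0 hYX => ?_⟩
    -- Since `r ≤ |U|`, the prescribed support size is at least one.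
    · rintro rfl
      have := h.le_card
      simp [support] at hc
      omega
    · refine hYX.eq_of_support_subset (eq_of_subset_of_card_le hYX.support_subset ?_).ge
      have := h.le_card_support Y hY hY0
      omega
  refine ⟨r, h.le_card, fun W hW => ?_, fun A hA => ?_⟩
  · by_contra hne
    have hle := h.le_card_support W hW.1 hW.2.1
    obtain ⟨A, hAW, hA⟩ := exists_subset_card_eq (s := support W)
      (n := Fintype.card U + 1 - r) (by omega)
    have hrc := h.le_card
    obtain ⟨X, hX, rfl⟩ := h.exists_support_eq A (by omega)
    have hXc := hmin X hX (by omega)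
    obtain ⟨Y, hY, hY0, hYW, hYne⟩ := hL.exists_conforms_of_support_ssubset hW.1 hX hXc.2.1
      ⟨hAW, fun hle => by have := card_le_card hle; omega⟩
    exact hYne (hW.2.2 Y hY hY0 hYW)
  · obtain ⟨X, hX, hXA⟩ := h.exists_support_eq A hA
    refine ⟨X, Set.ext fun Y => ⟨?_, ?_⟩⟩
    · rintro ⟨hY, hYA⟩
      have hz : ∀ f, X f = 0 ↔ Y f = 0 := fun f => by
        rw [← not_iff_not, ← Ne, ← Ne, ← mem_support, ← mem_support, hXA, hYA]
      -- Two covectors with support `A`, neither equal nor opposite, disagree at some `e` and agree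
      -- at some `f`. Eliminating `e` leaves a nonzero covector of too small support.
      by_contra hne
      simp only [Set.mem_insert_iff, Set.mem_singleton_iff, not_or] at hne
      obtain ⟨e, he⟩ := Function.ne_iff.1 hne.1
      obtain ⟨f, hf⟩ := Function.ne_iff.1 hne.2
      have he' : X e * Y e = -1 := by
        by_contra h'
        by_cases h0 : X e = 0
        · exact he (by rw [h0, (hz e).1 h0])
        · exact he (eq_of_mul_ne_neg_one h0 (fun h => h0 ((hz e).2 h)) h').symm
      have hf0 : X f ≠ 0 := fun h0 => hf (by rw [(hz f).1 h0, Pi.neg_apply, h0]; rfl)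
      obtain ⟨Z, hZ, hZe, hZf⟩ := hL.strongElimination X hX Y hY.1 e he'
      have hZf' : ∀ f, X f * Y f ≠ -1 → Z f = comp X Y f := hZf
      have hZ0 : Z ≠ 0 := fun h => by
        have h1 := hZf' f fun h' => hf (eq_neg_of_mul_eq_neg_one h')
        rw [comp_of_ne_zero hf0, h] at h1
        exact hf0 h1.symm
      have hlt : (support Z).card < (support X).card := by
        refine card_lt_card ⟨fun g hg => ?_, fun hle => ?_⟩
        · rw [mem_support] at *
          intro h0
          rw [hZf' g (by rw [h0, zero_mul]; decide), comp_of_eq_zero h0, (hz g).1 h0] at hg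
          exact hg rfl
        · refine mem_support.1 (hle (x := e) (mem_support.2 fun h0 => ?_)) hZe
          rw [h0, zero_mul] at he'
          exact absurd he' (by decide)
      have := h.le_card_support Z hZ hZ0
      rw [hXA] at hlt
      omega
    · have hn := hL.symmetry X hX
      rintro (rfl | rfl)
      · exact ⟨hmin Y hX (by rw [hXA]; exact hA), hXA⟩
      · exact ⟨hmin _ hn (by rw [support_neg, hXA]; exact hA), by rw [support_neg, hXA]⟩

/-! ### Topes -/

lemma IsOrientedMatroid.exists_forall_ne_zero (hL : IsOrientedMatroid L) (hs : IsSimple L) :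
    ∃ T ∈ L, ∀ e, T e ≠ 0 := by
  classical
  suffices h : ∀ A : Finset U, ∃ T ∈ L, ∀ e ∈ A, T e ≠ 0 by
    obtain ⟨T, hT, h⟩ := h univ
    exact ⟨T, hT, fun e => h e (mem_univ _)⟩
  intro A
  induction A using Finset.induction_on with
  | empty =>
    obtain ⟨T, hT⟩ := hL.nonempty
    exact ⟨T, hT, by simp⟩
  | insert e A _ ih =>
    obtain ⟨T, hT, h⟩ := ih
    obtain ⟨X, hX, hXe⟩ := hs.all_signs e 1
    refine ⟨comp T X, hL.composition T hT X hX, fun f hf => comp_ne_zero ?_⟩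
    rcases mem_insert.1 hf with rfl | hf
    · right; rw [hXe]; decide
    · exact Or.inl (h f hf)

/-- Composing a maximal covector with a nowhere zero one cannot change it, so it has no zeros. -/
lemma IsOrientedMatroid.isTope_iff (hL : IsOrientedMatroid L) (hs : IsSimple L)
    {T : U → SignType} : IsTope L T ↔ T ∈ L ∧ ∀ e, T e ≠ 0 := by
  refine and_congr_right fun hT => ⟨fun h e => ?_, fun h Y _ hc => ?_⟩
  · obtain ⟨T₀, hT₀, h0⟩ := hL.exists_forall_ne_zero hs
    rw [← h _ (hL.composition T hT T₀ hT₀) (conforms_comp T T₀)]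
    exact comp_ne_zero (Or.inr (h0 e))
  · exact funext fun e => ((hc e).resolve_left (h e)).symm

lemma HasUniformRank.exists_compl_support [DecidableEq U] (hL : IsOrientedMatroid L) {r : ℕ}
    (h : HasUniformRank L r) {Y : Finset U} {e : U} (he : e ∉ Y) (hY : Y.card + 1 = r)
    {s : SignType} (hs : s ≠ 0) : ∃ C ∈ L, C e = s ∧ ∀ f, C f = 0 ↔ f ∈ Y := by
  have hc := card_compl_add_card Y
  obtain ⟨X, hX, hXA⟩ := h.exists_support_eq Yᶜ (by omega)
  have hz : ∀ f, X f = 0 ↔ f ∈ Y := fun f => by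
    rw [← not_iff_not, ← Ne, ← mem_support, hXA, mem_compl]
  by_cases hXs : X e = s
  · exact ⟨X, hX, hXs, hz⟩
  · refine ⟨-X, hL.symmetry X hX, ?_, fun f => ?_⟩
    · have h0 : X e ≠ 0 := fun h0 => he ((hz e).1 h0)
      rw [Pi.neg_apply]
      generalize X e = a at *
      revert a s; decide
    · rw [← hz f, Pi.neg_apply]
      generalize X f = a
      revert a; decide

/-- On a set of size at most the rank, topes take all sign patterns. -/
lemma HasUniformRank.exists_eq_on (hL : IsOrientedMatroid L) (hs : IsSimple L) {r : ℕ}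
    (h : HasUniformRank L r) {X : Finset U} (hX : X.card ≤ r) {σ : U → SignType}
    (hσ : ∀ f, σ f ≠ 0) : ∃ T ∈ L, (∀ f, T f ≠ 0) ∧ ∀ f ∈ X, T f = σ f := by
  classical
  -- Padding to size exactly `r` makes each `X'.erase e` the zero set of some covector.
  obtain ⟨X', hXX', -, hX'⟩ := exists_subsuperset_card_eq (subset_univ X) hX
    (by rw [card_univ]; exact h.le_card)
  suffices hA : ∀ A ⊆ X', ∃ T ∈ L, (∀ f, T f ≠ 0) ∧ ∀ f ∈ A, T f = σ f by
    obtain ⟨T, hT, h1, h2⟩ := hA X' Subset.rfl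
    exact ⟨T, hT, h1, fun f hf => h2 f (hXX' hf)⟩
  intro A
  induction A using Finset.induction_on with
  | empty =>
    obtain ⟨T, hT, h0⟩ := hL.exists_forall_ne_zero hs
    exact fun _ => ⟨T, hT, h0, by simp⟩
  | insert e A heA ih =>
    intro hA
    obtain ⟨T, hT, h0, h1⟩ := ih ((subset_insert _ _).trans hA)
    have heX := hA (mem_insert_self e A)
    have hpos := card_pos.2 ⟨e, heX⟩
    obtain ⟨C, hC, hCe, hC0⟩ := h.exists_compl_support hL (notMem_erase e X')
      (by rw [card_erase_of_mem heX]; omega) (hσ e)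
    -- `C` sets the sign at `e` and vanishes on the rest of `X'`, where the signs of `T` pass
    -- through.
    refine ⟨comp C T, hL.composition C hC T hT, fun f => comp_ne_zero (Or.inr (h0 f)), ?_⟩
    intro f hf
    rcases mem_insert.1 hf with rfl | hfA
    · rw [comp_of_ne_zero (by rw [hCe]; exact hσ f), hCe]
    · have hfe : f ≠ e := by rintro rfl; exact heA hfA
      rw [comp_of_eq_zero ((hC0 f).2 (mem_erase.2 ⟨hfe, hA hf⟩)), h1 f hfA]

/-- If covectors take all full sign patterns on `X`, then `X` has at most `r` elements. -/
lemma HasUniformRank.card_le (hL : IsOrientedMatroid L) {r : ℕ} (h : HasUniformRank L r)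
    {X : Finset U} (hX : ∀ σ : U → SignType, (∀ f, σ f ≠ 0) → ∃ T ∈ L, ∀ f ∈ X, T f = σ f) :
    X.card ≤ r := by
  classical
  -- Patterns with zeros are attained as well: eliminating between the values `1` and `-1` at `e`
  -- gives the zero there.
  have hA : ∀ A : Finset U, ∀ σ : U → SignType, (∀ f, σ f = 0 ↔ f ∈ A) →
      ∃ T ∈ L, ∀ f ∈ X, T f = σ f := by
    intro A
    induction A using Finset.induction_on with
    | empty => exact fun σ hσ => hX σ fun f => by simp [hσ]
    | insert e A heA ih =>
      intro σ hσ
      have hup : ∀ s : SignType, s ≠ 0 →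
          ∃ T ∈ L, ∀ f ∈ X, T f = Function.update σ e s f := by
        refine fun s hs => ih _ fun f => ?_
        by_cases hfe : f = e
        · subst hfe; simp [hs, heA]
        · simp [hfe, hσ]
      obtain ⟨T₁, hT₁, h₁⟩ := hup 1 (by decide)
      obtain ⟨T₂, hT₂, h₂⟩ := hup (-1) (by decide)
      by_cases heX : e ∈ X
      · have e1 : T₁ e = 1 := by simpa using h₁ e heX
        have e2 : T₂ e = -1 := by simpa using h₂ e heX
        obtain ⟨Z, hZ, hZe, hZf⟩ := hL.strongElimination T₁ hT₁ T₂ hT₂ e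
          (show T₁ e * T₂ e = -1 by rw [e1, e2]; decide)
        refine ⟨Z, hZ, fun f hf => ?_⟩
        by_cases hfe : f = e
        · rw [hfe, hZe, (hσ e).2 (mem_insert_self _ _)]
        · have f1 : T₁ f = σ f := by simpa [hfe] using h₁ f hf
          have f2 : T₂ f = σ f := by simpa [hfe] using h₂ f hf
          rw [hZf f (show T₁ f * T₂ f ≠ -1 by
            rw [f1, f2]; generalize σ f = a; revert a; decide)]
          unfold comp
          rw [f1, f2, ite_self]
      · refine ⟨T₁, hT₁, fun f hf => ?_⟩
        have hfe : f ≠ e := by rintro rfl; exact heX hf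
        simpa [hfe] using h₁ f hf
  rcases X.eq_empty_or_nonempty with rfl | ⟨e, he⟩
  · simp
  -- A covector that is nonzero at only one element of `X` has support of size at most `|U| - |X| +
  -- 1`, against the lower bound `|U| - r + 1`.
  · obtain ⟨T, hT, h1⟩ := hA (univ.erase e) (Pi.single e 1) fun f => by
      by_cases hfe : f = e
      · subst hfe; simp
      · simp [hfe]
    have hTe : T e = 1 := by simpa using h1 e he
    have hT0 : T ≠ 0 := fun h0 => by rw [h0] at hTe; exact absurd (show (0 : SignType) = 1 from hTe) (by decide)
    have hsub : support T ⊆ insert e Xᶜ := fun f hf => by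
      rw [mem_insert, mem_compl]
      by_contra! hcon
      refine mem_support.1 hf ?_
      rw [h1 f hcon.2, Pi.single_eq_of_ne hcon.1]
    have h2 := (card_le_card hsub).trans (card_insert_le _ _)
    have h3 := h.le_card_support T hT hT0
    have h4 := card_compl_add_card X
    omega

end Fintype

end SignSystem

/-! ### Tope families of uniform oriented matroids -/

namespace SetFamily

open Finset SignSystem

/-- The restriction of a sign vector to a smaller ground set. -/
def restrictSign {V : Type*} {U U' : Finset V} (h : U' ⊆ U) (X : U → SignType) : U' → SignType :=
  fun v => X ⟨v, h v.2⟩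

/-! ### Restriction of oriented matroids to fewer elements -/

section Restriction

variable {V : Type*} {U U' : Finset V} {L : Set (U → SignType)}

lemma isOrientedMatroid_image_restrictSign (h : U' ⊆ U) (hL : IsOrientedMatroid L) :
    IsOrientedMatroid (restrictSign h '' L) where
  nonempty := hL.nonempty.image _
  composition := by
    rintro _ ⟨X, hX, rfl⟩ _ ⟨Y, hY, rfl⟩
    exact ⟨comp X Y, hL.composition X hX Y hY, rfl⟩
  strongElimination := by
    rintro _ ⟨X, hX, rfl⟩ _ ⟨Y, hY, rfl⟩ e he
    obtain ⟨Z, hZ, hZe, hZf⟩ := hL.strongElimination X hX Y hY ⟨e, h e.2⟩ he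
    exact ⟨_, ⟨Z, hZ, rfl⟩, hZe, fun f hf => hZf ⟨f, h f.2⟩ hf⟩
  symmetry := by
    rintro _ ⟨X, hX, rfl⟩
    exact ⟨-X, hL.symmetry X hX, rfl⟩

lemma isSimple_image_restrictSign (h : U' ⊆ U) (hL : IsSimple L) :
    IsSimple (restrictSign h '' L) where
  all_signs e s := by
    obtain ⟨X, hX, hXe⟩ := hL.all_signs ⟨e, h e.2⟩ s
    exact ⟨_, ⟨X, hX, rfl⟩, hXe⟩
  not_parallel e f hef := by
    obtain ⟨⟨X, hX, h1⟩, Y, hY, h2⟩ := hL.not_parallel ⟨e, h e.2⟩ ⟨f, h f.2⟩ fun heq =>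
      hef (Subtype.ext (congrArg (fun x : U => (x : V)) heq))
    exact ⟨⟨_, ⟨X, hX, rfl⟩, h1⟩, _, ⟨Y, hY, rfl⟩, h2⟩

lemma mem_map_support (X : U → SignType) {v : V} :
    v ∈ (support X).map (Function.Embedding.subtype _) ↔ ∃ h : v ∈ U, X ⟨v, h⟩ ≠ 0 := by
  simp [support]

end Restriction

variable {V : Type*} [DecidableEq V]

/-- The `±1`-vector on `U` that represents a set. -/
def signOf (U S : Finset V) : U → SignType := fun v => if (v : V) ∈ S then 1 else -1

lemma signOf_ne_zero {U S : Finset V} (v : U) : signOf U S v ≠ 0 := by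
  unfold signOf
  split_ifs <;> decide

lemma mem_union_positivePart {U B : Finset V} {T : U → SignType} {v : V} :
    v ∈ B ∪ (positivePart T).map (Function.Embedding.subtype _) ↔
      v ∈ B ∨ ∃ h : v ∈ U, T ⟨v, h⟩ = 1 := by
  simp [positivePart]

lemma signOf_union_positivePart {U B : Finset V} (hUB : Disjoint U B) {T : U → SignType}
    (hT : ∀ v, T v ≠ 0) :
    signOf U (B ∪ (positivePart T).map (Function.Embedding.subtype _)) = T := by
  funext v
  have hv : (v : V) ∉ B := disjoint_left.1 hUB v.2
  have h0 := hT v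
  by_cases h1 : T v = 1
  · rw [signOf, if_pos (mem_union_positivePart.2 (Or.inr ⟨v.2, h1⟩)), h1]
  · rw [signOf, if_neg]
    · exact (eq_neg_one_of_ne h0 h1).symm
    · rw [mem_union_positivePart]
      rintro (h | ⟨_, h⟩)
      · exact hv h
      · exact h1 h

lemma union_positivePart_signOf {U B S : Finset V} (hUB : Disjoint U B)
    (hS : ∀ v ∉ U, (v ∈ S ↔ v ∈ B)) :
    B ∪ (positivePart (signOf U S)).map (Function.Embedding.subtype _) = S := by
  ext v
  rw [mem_union_positivePart]
  by_cases hv : v ∈ U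
  · have hvB : v ∉ B := disjoint_left.1 hUB hv
    by_cases hvS : v ∈ S <;> simp [hv, hvB, hvS, signOf]
  · simp [hv, hS v hv]

/-- `𝒢` is the tope family of the simple oriented matroid `L` of uniform rank `r` on `U`, with
least vertex `B`. -/
structure IsTopeFamily (𝒢 : Finset (Finset V)) (U B : Finset V) (L : Set (U → SignType))
    (r : ℕ) : Prop where
  disjoint : Disjoint U B
  isOrientedMatroid : IsOrientedMatroid L
  isSimple : IsSimple L
  hasUniformRank : HasUniformRank L r
  mem_iff : ∀ S, S ∈ 𝒢 ↔ (∀ v ∉ U, (v ∈ S ↔ v ∈ B)) ∧ signOf U S ∈ L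

/-- Replaces maximality of covectors by a membership test on `signOf U S`, which behaves well under
restriction. -/
lemma forall_mem_iff_exists_isTope_iff {𝒢 : Finset (Finset V)} {U B : Finset V}
    {L : Set (U → SignType)} (hUB : Disjoint U B) (hL : IsOrientedMatroid L) (hs : IsSimple L) :
    (∀ S, S ∈ 𝒢 ↔ ∃ T, IsTope L T ∧
      S = B ∪ (positivePart T).map (Function.Embedding.subtype _)) ↔
    ∀ S, S ∈ 𝒢 ↔ (∀ v ∉ U, (v ∈ S ↔ v ∈ B)) ∧ signOf U S ∈ L := by
  refine forall_congr' fun S => iff_congr Iff.rfl ⟨?_, ?_⟩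
  · rintro ⟨T, hT, rfl⟩
    rw [hL.isTope_iff hs] at hT
    refine ⟨fun v hv => ?_, ?_⟩
    · rw [mem_union_positivePart]
      simp [hv]
    · rw [signOf_union_positivePart hUB hT.2]
      exact hT.1
  · rintro ⟨h1, h2⟩
    exact ⟨signOf U S, (hL.isTope_iff hs).2 ⟨h2, signOf_ne_zero⟩,
      (union_positivePart_signOf hUB h1).symm⟩

lemma IsUOM.exists_isTopeFamily {𝒢 : Finset (Finset V)} (h : IsUOM 𝒢) :
    ∃ U B L r, IsTopeFamily 𝒢 U B L r := by
  obtain ⟨U, B, L, hUB, hL, hs, hu, hmem⟩ := h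
  obtain ⟨r, hr⟩ := hu.exists_hasUniformRank
  exact ⟨U, B, L, r, hUB, hL, hs, hr, (forall_mem_iff_exists_isTope_iff hUB hL hs).1 hmem⟩

namespace IsTopeFamily

variable {𝒢 : Finset (Finset V)} {U B : Finset V} {L : Set (U → SignType)} {r : ℕ}

lemma isUOM (h : IsTopeFamily 𝒢 U B L r) : IsUOM 𝒢 :=
  ⟨U, B, L, h.disjoint, h.isOrientedMatroid, h.isSimple,
    h.hasUniformRank.isUniform h.isOrientedMatroid,
    (forall_mem_iff_exists_isTope_iff h.disjoint h.isOrientedMatroid h.isSimple).2 h.mem_iff⟩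

lemma union_positivePart_mem (h : IsTopeFamily 𝒢 U B L r) {T : U → SignType} (hT : T ∈ L)
    (h0 : ∀ v, T v ≠ 0) :
    B ∪ (positivePart T).map (Function.Embedding.subtype _) ∈ 𝒢 := by
  rw [h.mem_iff, signOf_union_positivePart h.disjoint h0]
  refine ⟨fun v hv => ?_, hT⟩
  rw [mem_union_positivePart]
  simp [hv]

lemma nonempty (h : IsTopeFamily 𝒢 U B L r) : 𝒢.Nonempty := by
  obtain ⟨T, hT, h0⟩ := h.isOrientedMatroid.exists_forall_ne_zero h.isSimple
  exact ⟨_, h.union_positivePart_mem hT h0⟩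

lemma mem_of_exists (h : IsTopeFamily 𝒢 U B L r) {e : V} (h1 : ∃ S ∈ 𝒢, e ∈ S)
    (h2 : ∃ S ∈ 𝒢, e ∉ S) : e ∈ U := by
  by_contra he
  obtain ⟨S, hS, heS⟩ := h1
  obtain ⟨T, hT, heT⟩ := h2
  exact heT (((((h.mem_iff T).1 hT).1 e he)).2 ((((h.mem_iff S).1 hS).1 e he).1 heS))

lemma card_subtype_of_subset {X : Finset V} (hX : X ⊆ U) :
    (X.subtype (· ∈ U)).card = X.card := by
  rw [card_subtype, filter_true_of_mem fun x hx => hX hx]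

/-- The shattered sets of a uniform oriented matroid are those of size at most the rank. -/
lemma shatters_iff (h : IsTopeFamily 𝒢 U B L r) {X : Finset V} :
    𝒢.Shatters X ↔ X ⊆ U ∧ X.card ≤ r := by
  constructor
  · intro hX
    have hXU : X ⊆ U := fun v hv => by
      obtain ⟨h1, h2⟩ := Shatters.exists_mem_and_notMem hX hv
      exact h.mem_of_exists h1 h2
    refine ⟨hXU, ?_⟩
    rw [← card_subtype_of_subset hXU]
    refine h.hasUniformRank.card_le h.isOrientedMatroid fun σ hσ => ?_
    rw [shatters_iff_forall_mem_iff] at hX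
    obtain ⟨S, hS, hSX⟩ := hX (X.filter fun v => ∃ h : v ∈ U, σ ⟨v, h⟩ = 1) (filter_subset _ _)
    refine ⟨signOf U S, ((h.mem_iff S).1 hS).2, fun v hv => ?_⟩
    rw [mem_subtype] at hv
    have h1 := hSX v hv
    have h2 : (v : V) ∈ S ↔ σ v = 1 := by simpa [hv] using h1
    have h0 := hσ v
    unfold signOf
    split_ifs with h3
    · exact (h2.1 h3).symm
    · exact (eq_neg_one_of_ne h0 (mt h2.2 h3)).symm
  · rintro ⟨hXU, hX⟩
    rw [shatters_iff_forall_mem_iff]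
    intro Y _
    obtain ⟨T, hT, h0, h1⟩ := h.hasUniformRank.exists_eq_on h.isOrientedMatroid h.isSimple
      (X := X.subtype (· ∈ U)) (by rwa [card_subtype_of_subset hXU]) (σ := signOf U Y)
      signOf_ne_zero
    refine ⟨_, h.union_positivePart_mem hT h0, fun v hv => ?_⟩
    have hvU := hXU hv
    have hvB := disjoint_left.1 h.disjoint hvU
    have h2 := h1 ⟨v, hvU⟩ (mem_subtype.2 hv)
    rw [mem_union_positivePart]
    by_cases hvY : v ∈ Y
    · simp only [signOf, hvY, if_true] at h2
      simp [hvU, h2, hvY]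
    · simp only [signOf, hvY, if_false] at h2
      simp only [hvB, hvY, hvU, h2, false_or, exists_true_left, iff_false]
      decide

/-- The reflection of a member of the family in its cube is again a member. -/
lemma exists_antipode (h : IsTopeFamily 𝒢 U B L r) {S : Finset V} (hS : S ∈ 𝒢) :
    ∃ S' ∈ 𝒢, ∀ v ∈ U, (v ∈ S' ↔ v ∉ S) := by
  have h0 : ∀ v, (-signOf U S) v ≠ 0 := fun v => by
    have := signOf_ne_zero (S := S) v
    rw [Pi.neg_apply]
    generalize signOf U S v = a at *
    revert a; decide
  refine ⟨_, h.union_positivePart_mem (h.isOrientedMatroid.symmetry _ ((h.mem_iff S).1 hS).2) h0,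
    fun v hv => ?_⟩
  have hvB := disjoint_left.1 h.disjoint hv
  rw [mem_union_positivePart]
  by_cases hvS : v ∈ S
  · simp only [hvB, hv, hvS, signOf, Pi.neg_apply, false_or, exists_true_left, if_true,
      not_true, iff_false]
    decide
  · simp [hvB, hv, hvS, signOf]

/-- The antipode of a member of the positive halfspace lies in the negative one and has the
complementary trace on `X`, so both halfspaces shatter `X`. -/
lemma shatters_insert_of_positiveHalfspace (h : IsTopeFamily 𝒢 U B L r) {e : V} (he : e ∈ U)
    {X : Finset V} (hX : (positiveHalfspace e 𝒢).Shatters X) : 𝒢.Shatters (insert e X) := by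
  have hXU := (h.shatters_iff.1 (hX.mono_left (filter_subset _ _))).1
  refine shatters_insert_of_halfspaces hX ?_
  rw [shatters_iff_forall_mem_iff] at *
  intro Y _
  obtain ⟨S, hS, hSX⟩ := hX (X \ Y) sdiff_subset
  obtain ⟨S', hS', hSS'⟩ := h.exists_antipode (mem_filter.1 hS).1
  refine ⟨S', mem_filter.2 ⟨hS', fun heS => (hSS' e he).1 heS (mem_filter.1 hS).2⟩,
    fun x hx => ?_⟩
  rw [hSS' x (hXU hx), hSX x hx, mem_sdiff]
  tauto

/-- The positive halfspaces of a uniform oriented matroid are ample. -/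
lemma isAmple_positiveHalfspace [Fintype V] (h : IsTopeFamily 𝒢 U B L r) {e : V} (he : e ∈ U) :
    IsAmple (positiveHalfspace e 𝒢) := by
  refine isAmple_of_forall_stronglyShatters fun X hX => ?_
  have heX := notMem_of_positiveHalfspace_shatters hX
  obtain ⟨hU, hc⟩ := h.shatters_iff.1 (h.shatters_insert_of_positiveHalfspace he hX)
  rw [card_insert_of_notMem heX] at hc
  have hr := h.hasUniformRank.le_card
  rw [Fintype.card_coe] at hr
  -- `r - 1` is the size of a cocircuit's zero set; `Y` avoids `e` so that the cocircuit can be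
  -- positive there.
  obtain ⟨Y, hXY, hYU, hY⟩ := exists_subsuperset_card_eq (s := X) (t := U.erase e) (n := r - 1)
    (fun x hx => mem_erase.2 ⟨fun hxe => heX (hxe ▸ hx), hU (mem_insert_of_mem hx)⟩)
    (by omega) (by rw [card_erase_of_mem he]; omega)
  have hYU' : Y ⊆ U := hYU.trans (erase_subset _ _)
  have heY : e ∉ Y := fun h => by simpa using hYU h
  obtain ⟨C, hC, hCe, hC0⟩ := h.hasUniformRank.exists_compl_support h.isOrientedMatroid
    (Y := Y.subtype (· ∈ U)) (e := ⟨e, he⟩) (by simpa using heY)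
    (by rw [card_subtype_of_subset hYU']; omega) (s := 1) (by decide)
  refine ⟨B ∪ (positivePart C).map (Function.Embedding.subtype _), fun S hS => ?_⟩
  have hS' : ∀ v ∉ Y, (v ∈ S ↔ v ∈ B ∨ ∃ h : v ∈ U, C ⟨v, h⟩ = 1) := fun v hv => by
    rw [hS v fun hvX => hv (hXY hvX), mem_union_positivePart]
  obtain ⟨T, hT, -, hTY⟩ := h.hasUniformRank.exists_eq_on h.isOrientedMatroid h.isSimple
    (X := Y.subtype (· ∈ U)) (by rw [card_subtype_of_subset hYU']; omega) (σ := signOf U S)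
    signOf_ne_zero
  refine mem_filter.2 ⟨(h.mem_iff S).2 ⟨fun v hv => ?_, ?_⟩, ?_⟩
  · rw [hS' v fun h => hv (hYU' h)]
    simp [hv]
  -- Off `Y` the signs of `S` are those of `C`; on `Y`, where `C` vanishes, `T` was chosen to match
  -- `S`.
  · have : signOf U S = comp C T := by
      funext v
      by_cases hvY : (v : V) ∈ Y
      · rw [comp_of_eq_zero ((hC0 v).2 (mem_subtype.2 hvY)), hTY v (mem_subtype.2 hvY)]
      · have hC0v : C v ≠ 0 := fun h0 => hvY (mem_subtype.1 ((hC0 v).1 h0))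
        rw [comp_of_ne_zero hC0v]
        have hvB := disjoint_left.1 h.disjoint v.2
        have h1 : (v : V) ∈ S ↔ C v = 1 := by
          rw [hS' v hvY]
          simp [hvB]
        unfold signOf
        split_ifs with h2
        · exact (h1.1 h2).symm
        · exact (eq_neg_one_of_ne hC0v (mt h1.2 h2)).symm
    rw [this]
    exact h.isOrientedMatroid.composition C hC T hT
  · exact (hS' e heY).2 (Or.inr ⟨he, hCe⟩)

end IsTopeFamily

/-! ### Contraction of tope families as deletion -/

section Deletion

variable {U : Finset V} {L : Set (U → SignType)}

lemma map_support_restrictSign {e : V} (X : U → SignType) :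
    (support (restrictSign (erase_subset e U) X)).map (Function.Embedding.subtype _) =
      ((support X).map (Function.Embedding.subtype _)).erase e := by
  ext v
  rw [mem_erase, mem_map_support, mem_map_support]
  constructor
  · rintro ⟨h, hX⟩
    exact ⟨(mem_erase.1 h).1, (mem_erase.1 h).2, hX⟩
  · rintro ⟨hve, h, hX⟩
    exact ⟨mem_erase.2 ⟨hve, h⟩, hX⟩

/-- Deleting an element keeps the rank, unless all elements are independent. -/
lemma hasUniformRank_image_restrictSign {e : V} (he : e ∈ U) {r : ℕ} (hr : HasUniformRank L r) :
    HasUniformRank (restrictSign (erase_subset e U) '' L) (min r (U.card - 1)) := by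
  have hc := card_erase_of_mem he
  have hpos : 0 < U.card := card_pos.2 ⟨e, he⟩
  have hrc := hr.le_card
  rw [Fintype.card_coe] at hrc
  refine ⟨?_, ?_, fun A hA => ?_⟩
  · rw [Fintype.card_coe, hc]
    exact min_le_right _ _
  · rintro _ ⟨X, hX, rfl⟩ h0
    -- When `r = |U|` the required size is one, which is just nonemptiness; otherwise it follows
    -- from losing at most the element `e`.
    have hp := card_pos.2 (support_nonempty h0)
    have h1 := hr.le_card_support X hX fun h => h0 (by rw [h]; rfl)
    have h2 : (support X).card - 1 ≤ (support (restrictSign (erase_subset e U) X)).card := by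
      rw [← card_map (Function.Embedding.subtype _) (s := support (restrictSign _ X)),
        map_support_restrictSign, ← card_map (Function.Embedding.subtype _) (s := support X)]
      exact pred_card_le_card_erase
    rw [Fintype.card_coe] at h1
    rw [Fintype.card_coe, hc]
    omega
  · rw [Fintype.card_coe, hc] at hA
    set A' := A.map (Function.Embedding.subtype _) with hA'
    have hsub : A' ⊆ U.erase e := fun v hv => by
      obtain ⟨w, -, rfl⟩ := mem_map.1 hv
      exact w.2
    have heA : e ∉ A' := fun h => by simpa using hsub h
    have hcA : A'.card = A.card := card_map _
    -- `A''` lifts `A` to a support size of `L`: if `r < |U|` one element is missing and `e` is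
    -- added; if `r = |U|` both sizes are one.
    obtain ⟨A'', hsub', hcard, herase⟩ : ∃ A'' ⊆ U, A''.card + r = U.card + 1 ∧
        A''.erase e = A' := by
      by_cases hlt : r < U.card
      · refine ⟨insert e A', insert_subset he (hsub.trans (erase_subset _ _)), ?_,
          erase_insert heA⟩
        rw [card_insert_of_notMem heA]
        omega
      · exact ⟨A', hsub.trans (erase_subset _ _), by omega, erase_eq_of_notMem heA⟩
    obtain ⟨X, hX, hXA⟩ := hr.exists_support_eq (A''.subtype (· ∈ U))
      (by rw [IsTopeFamily.card_subtype_of_subset hsub', Fintype.card_coe, hcard])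
    refine ⟨_, ⟨X, hX, rfl⟩, ?_⟩
    apply map_injective (Function.Embedding.subtype _)
    rw [map_support_restrictSign, hXA, ← hA', ← herase, subtype_map, filter_true_of_mem]
    exact fun x hx => hsub' hx

lemma IsTopeFamily.contraction {𝒢 : Finset (Finset V)} {B : Finset V} {r : ℕ}
    (h : IsTopeFamily 𝒢 U B L r) {e : V} (he : e ∈ U) :
    IsTopeFamily (contraction e 𝒢) (U.erase e) B (restrictSign (erase_subset e U) '' L)
      (min r (U.card - 1)) := by
  have heB := disjoint_left.1 h.disjoint he
  refine ⟨disjoint_of_subset_left (erase_subset _ _) h.disjoint,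
    isOrientedMatroid_image_restrictSign _ h.isOrientedMatroid,
    isSimple_image_restrictSign _ h.isSimple,
    hasUniformRank_image_restrictSign he h.hasUniformRank, fun S => ⟨fun hS => ?_, ?_⟩⟩
  · obtain ⟨R, hR, rfl⟩ := mem_image.1 hS
    obtain ⟨h1, h2⟩ := (h.mem_iff R).1 hR
    refine ⟨fun v hv => ?_, signOf U R, h2, funext fun v => ?_⟩
    · by_cases hve : v = e
      · subst hve
        simp [heB]
      · rw [mem_erase, h1 v fun hvU => hv (mem_erase.2 ⟨hve, hvU⟩)]
        simp [hve]
    · simp [restrictSign, signOf, (mem_erase.1 v.2).1]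
  · rintro ⟨h1, X, hX, hXS⟩
    -- `X` may vanish at `e`; composing with `T` fills this in without changing the other signs on
    -- `U`.
    obtain ⟨T, hT, h0⟩ := h.isOrientedMatroid.exists_forall_ne_zero h.isSimple
    refine mem_image.2 ⟨_, h.union_positivePart_mem (h.isOrientedMatroid.composition X hX T hT)
      fun v => comp_ne_zero (Or.inr (h0 v)), ?_⟩
    ext v
    rw [mem_erase, mem_union_positivePart]
    by_cases hve : v = e
    · subst hve
      simp [h1 v (notMem_erase _ _), heB]
    by_cases hv : v ∈ U
    · have hvB := disjoint_left.1 h.disjoint hv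
      have h2 : X ⟨v, hv⟩ = signOf (U.erase e) S ⟨v, mem_erase.2 ⟨hve, hv⟩⟩ := by
        rw [← hXS]; rfl
      have h3 : comp X T ⟨v, hv⟩ = X ⟨v, hv⟩ :=
        comp_of_ne_zero (by rw [h2]; exact signOf_ne_zero _)
      simp only [hve, hvB, hv, h3, h2, signOf, ne_eq, not_false_eq_true, true_and, false_or,
        exists_true_left]
      by_cases hvS : v ∈ S <;> simp [hvS]
    · rw [h1 v fun h => hv (mem_erase.1 h).2]
      simp [hve, hv]

end Deletion

/-! ### Ample completions -/

variable [Fintype V] {𝒢 : Finset (Finset V)}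

lemma IsUOM.contraction (h : IsUOM 𝒢) {e : V} (he : e ∈ thetaClasses 𝒢) :
    IsUOM (contraction e 𝒢) := by
  obtain ⟨U, B, L, r, h⟩ := h.exists_isTopeFamily
  obtain ⟨h1, h2⟩ := mem_thetaClasses.1 he
  exact (h.contraction (h.mem_of_exists h1 h2)).isUOM

lemma IsUOM.isAmple_positiveHalfspace (h : IsUOM 𝒢) {e : V} (he : e ∈ thetaClasses 𝒢) :
    IsAmple (positiveHalfspace e 𝒢) := by
  obtain ⟨U, B, L, r, h⟩ := h.exists_isTopeFamily
  obtain ⟨h1, h2⟩ := mem_thetaClasses.1 he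
  exact h.isAmple_positiveHalfspace (h.mem_of_exists h1 h2)

lemma IsUOM.isAmpleCompletion_peripheralExpansion (h : IsUOM 𝒢) {e : V}
    (he : e ∈ thetaClasses 𝒢) {𝒜 : Finset (Finset V)}
    (h𝒜 : IsAmpleCompletion (SetFamily.contraction e 𝒢) 𝒜) :
    IsAmpleCompletion 𝒢
      (peripheralExpansion e 𝒜 (SetFamily.contraction e (positiveHalfspace e 𝒢))) := by
  refine h𝒜.peripheralExpansion he (h.isAmple_positiveHalfspace he) fun X hX => ?_
  obtain ⟨U, B, L, r, h⟩ := h.exists_isTopeFamily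
  obtain ⟨h1, h2⟩ := mem_thetaClasses.1 he
  exact h.shatters_insert_of_positiveHalfspace (h.mem_of_exists h1 h2) hX

lemma isAmple_singleton (S : Finset V) : IsAmple {S} := by
  refine isAmple_of_forall_stronglyShatters fun X hX => ⟨S, fun T hT => ?_⟩
  rw [mem_singleton]
  ext x
  refine hT x fun hx => ?_
  obtain ⟨⟨R, hR, h1⟩, R', hR', h2⟩ := Shatters.exists_mem_and_notMem hX hx
  rw [mem_singleton] at hR hR'
  exact h2 (by rwa [hR', ← hR])

theorem IsUOM.exists_isAmpleCompletion (h : IsUOM 𝒢) : ∃ 𝒜, IsAmpleCompletion 𝒢 𝒜 := by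
  induction hn : thetaClasses 𝒢 using Finset.strongInduction generalizing 𝒢 with
  | H D ih =>
    subst hn
    rcases (thetaClasses 𝒢).eq_empty_or_nonempty with h0 | ⟨e, he⟩
    -- Without Θ-classes all members coincide, so the family is a single vertex and is its own
    -- completion.
    · obtain ⟨U, B, L, r, hT⟩ := h.exists_isTopeFamily
      obtain ⟨S, hS⟩ := hT.nonempty
      have hG : 𝒢 = {S} := by
        refine eq_singleton_iff_unique_mem.2 ⟨hS, fun T hT => ?_⟩
        ext v
        have hv : v ∉ thetaClasses 𝒢 := by simp [h0]
        rw [mem_thetaClasses] at hv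
        by_contra hne
        by_cases hvS : v ∈ S
        · exact hv ⟨⟨S, hS, hvS⟩, T, hT, by tauto⟩
        · exact hv ⟨⟨T, hT, by tauto⟩, S, hS, hvS⟩
      refine ⟨𝒢, Subset.rfl, fun _ => mem_smallestCube, ?_, rfl⟩
      rw [hG]
      exact (isAmple_singleton S).isAmplePartialCube
    · obtain ⟨𝒜, h𝒜⟩ := ih _ (thetaClasses_contraction_ssubset he) (h.contraction he) rfl
      exact ⟨_, h.isAmpleCompletion_peripheralExpansion he h𝒜⟩

end SetFamily

theorem mainTheorem3 {V : Type*} [Fintype V] [DecidableEq V]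
    (𝒢 : Finset (Finset V)) (h𝒢 : SetFamily.IsUOM 𝒢) (d : ℕ) (hd : 𝒢.vcDim = d) :
    (∃ 𝒜 : Finset (Finset V),
      𝒢 ⊆ 𝒜 ∧ 𝒜 ⊆ SetFamily.smallestCube 𝒢 ∧ SetFamily.IsAmplePartialCube 𝒜 ∧ 𝒜.vcDim = d) ∧
    ∀ e ∈ SetFamily.thetaClasses 𝒢,
      SetFamily.IsUOM (SetFamily.contraction e 𝒢) ∧
      SetFamily.IsAmplePartialCube (SetFamily.positiveHalfspace e 𝒢) ∧
      SetFamily.IsAmplePartialCube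
        (SetFamily.contraction e (SetFamily.positiveHalfspace e 𝒢)) ∧
      ∀ 𝒜' : Finset (Finset V), SetFamily.IsAmpleCompletion (SetFamily.contraction e 𝒢) 𝒜' →
        SetFamily.IsAmpleCompletion 𝒢
          (SetFamily.peripheralExpansion e 𝒜'
            (SetFamily.contraction e (SetFamily.positiveHalfspace e 𝒢))) := by
  refine ⟨?_, fun e he => ?_⟩
  · obtain ⟨𝒜, h⟩ := h𝒢.exists_isAmpleCompletion
    exact ⟨𝒜, h.subset, h.subset_cube, h.ample, h.vcDim_eq.trans hd⟩
  · have hamp := h𝒢.isAmple_positiveHalfspace he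
    exact ⟨h𝒢.contraction he, hamp.isAmplePartialCube,
      hamp.contraction_positiveHalfspace.isAmplePartialCube,
      fun _ h => h𝒢.isAmpleCompletion_peripheralExpansion he h⟩
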